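/- Let $G$ be a finite loopless multigraph with maximum degree $\Delta(G)$ and chromatic index $\chi'(G)$, where $\chi'(G)$ is the least number of colours in an edge colouring such that any two distinct edges with a common end receive different colours. Let $d(v)$ be the number of edges incident with $v$, let $\mu(xv)$ be the number of edges joining $x$ and $v$, and let $N(x)$ be the set of vertices joined to $x$ by at least one edge. An edge $e$ is \emph{critical} if $\chi'(G-e)<\chi'(G)$, where $G-e$ is obtained by deleting the single edge $e$. Suppose that $\chi'(G)\ge\Delta(G)+1$ and that $e$ is a critical edge with ends $x$ and $y$. Then there is a set $X\subseteq N(x)$ with $y\in X$ and $|X|\ge 2$ such that \[\sum_{v\in X}\bigl(d(v)+\mu(xv)+1-\chi'(G)\bigr)\ \ge\ 2 .\] -/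

import Mathlib

namespace Graph

/-- The neighbourhood `N(x)`: all vertices joined to `x` by at least one edge. -/
def neighbours {α β : Type*} (G : Graph α β) (x : α) : Set α := {v | G.Adj x v}

/-- The degree `d(v)` in a loopless multigraph: the number of edges incident with `v`. -/
noncomputable def degree {α β : Type*} (G : Graph α β) (v : α) : ℕ := (G.incidenceSet v).ncard

/-- The multiplicity `μ(xv)`: the number of edges with ends `x` and `v`. -/
noncomputable def multiplicity {α β : Type*} (G : Graph α β) (x v : α) : ℕ :=
  {e | G.IsLink e x v}.ncard

/-- The maximum degree `Δ(G)` of a finite multigraph. -/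
noncomputable def maxDegree {α β : Type*} (G : Graph α β) : ℕ := sSup (G.degree '' G.vertexSet)

/-- A colouring of the edges is proper if any two distinct edges with a common end receive
different colours. -/
def IsProperEdgeColoring {α β κ : Type*} (G : Graph α β) (c : G.edgeSet → κ) : Prop :=
  ∀ e f : G.edgeSet, e ≠ f → ∀ v : α, G.Inc e.1 v → G.Inc f.1 v → c e ≠ c f

/-- `G` has a proper edge colouring with `k` colours. -/
def EdgeColorable {α β : Type*} (G : Graph α β) (k : ℕ) : Prop :=
  ∃ c : G.edgeSet → Fin k, G.IsProperEdgeColoring c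

/-- The chromatic index `χ'(G)` of a multigraph with finitely many edges: the least `k` such that
`G` has a proper edge colouring with `k` colours. -/
noncomputable def chromaticIndex {α β : Type*} (G : Graph α β) : ℕ := sInf {k | G.EdgeColorable k}

/-- For finitely many edges, the minimum defining the chromatic index is attained. -/
theorem edgeColorable_chromaticIndex {α β : Type*} (G : Graph α β) (hE : G.edgeSet.Finite) :
    G.EdgeColorable G.chromaticIndex := by
  have : Finite G.edgeSet := hE
  refine Nat.sInf_mem (s := {k | G.EdgeColorable k}) ⟨Nat.card G.edgeSet, ?_⟩
  exact ⟨Finite.equivFin G.edgeSet, fun e f hef _ _ _ h => hef ((Finite.equivFin _).injective h)⟩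

/-- For finitely many vertices, `maxDegree` bounds all degrees. -/
theorem degree_le_maxDegree {α β : Type*} (G : Graph α β) (hV : G.vertexSet.Finite) {v : α}
    (hv : v ∈ G.vertexSet) : G.degree v ≤ G.maxDegree :=
  le_csSup (hV.image _).bddAbove (Set.mem_image_of_mem _ hv)

/-- An edge is critical if deleting that single edge (and no edge parallel to it) lowers the
chromatic index. -/
def IsCriticalEdge {α β : Type*} (G : Graph α β) (e : β) : Prop :=
  e ∈ G.edgeSet ∧ (G.deleteEdges {e}).chromaticIndex < G.chromaticIndex

end Graph

/-!
The inequality is Vizing's fan inequality, obtained from a colouring of `G - e` with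
`k = χ'(G) - 1 ≥ Δ(G)` colours. A fan at `x` starts with the uncoloured edge `e` from `x` to `y`
and continues along coloured edges at `x` whose colours are missing at vertices reached before; let
`X` be the set of all vertices reached (`Graph.FanReach`). Since `G` has no colouring with `k`
colours, two things hold.

* No colour is missing both at `x` and at a vertex of `X` (`Graph.FanReach.disjoint_missing`):
  shifting colours along the fan would free a colour for `e`.
* No colour is missing at two vertices of `X` (`Graph.FanReach.eq_of_mem_missing`). As `k ≥ Δ(G)`,
  some colour `a` is missing at `x`. If `b` were missing at two vertices of `X`, then one of
  them would lie on another `a`-`b` Kempe chain than `x`, and exchanging colours on that chain would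
  contradict the first point.

So every colour missing at some `v ∈ X` occurs on exactly one edge at `x`, and this edge leads to
a vertex of `X` because the fan cannot be extended. Counting these edges together with `e` gives
`1 + ∑ v ∈ X, |missing v| ≤ ∑ v ∈ X, μ(xv)`, where `|missing v| ≥ k - d(v)`, and one more for `v = y`
because `e` is uncoloured. A colour missing at `y` provides a second vertex of `X`.
-/

/-! ### Graphs of maximum degree two -/

namespace SimpleGraph

/-- In a finite connected graph of maximum degree at most two, at most two vertices have degree at
most one: a connected graph on `n` vertices has degree sum at least `2 * n - 2`. -/
theorem Connected.eq_or_eq_or_eq_of_degree_le {V : Type*} [Fintype V] {H : SimpleGraph V}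
    [DecidableRel H.Adj] (hH : H.Connected) (h2 : ∀ v, H.degree v ≤ 2) {u v w : V}
    (hu : H.degree u ≤ 1) (hv : H.degree v ≤ 1) (hw : H.degree w ≤ 1) :
    u = v ∨ u = w ∨ v = w := by
  classical
  by_contra! hne
  obtain ⟨huv, huw, hvw⟩ := hne
  have hcard := hH.card_vert_le_card_edgeSet_add_one
  rw [Nat.card_eq_fintype_card, Nat.card_eq_fintype_card, ← edgeFinset_card] at hcard
  have hsum := H.sum_degrees_eq_twice_card_edges
  have hle : ∑ z, (H.degree z + if z ∈ ({u, v, w} : Finset V) then 1 else 0) ≤ ∑ _z : V, 2 := by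
    refine Finset.sum_le_sum fun z _ => ?_
    split_ifs with hz
    · simp only [Finset.mem_insert, Finset.mem_singleton] at hz
      rcases hz with rfl | rfl | rfl <;> omega
    · exact h2 z
  rw [Finset.sum_add_distrib, Finset.sum_ite_mem, Finset.univ_inter, Finset.sum_const,
    Finset.card_eq_three.2 ⟨u, v, w, huv, huw, hvw, rfl⟩, Finset.sum_const, Finset.card_univ] at hle
  simp only [smul_eq_mul] at hle
  omega

/-- The version of `SimpleGraph.Connected.eq_or_eq_or_eq_of_degree_le` for one component, all of
whose vertices lie in a finite set, of an arbitrary graph. -/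
theorem eq_or_eq_or_eq_of_reachable {V : Type*} {H : SimpleGraph V} {s : Set V} (hs : s.Finite)
    (hHs : ∀ v w, H.Adj v w → w ∈ s) (hfin : ∀ v, (H.neighborSet v).Finite)
    (h2 : ∀ v, (H.neighborSet v).ncard ≤ 2)
    {u v w : V} (hu : (H.neighborSet u).ncard ≤ 1) (hv : (H.neighborSet v).ncard ≤ 1)
    (hw : (H.neighborSet w).ncard ≤ 1) (huv : H.Reachable u v) (huw : H.Reachable u w) :
    u = v ∨ u = w ∨ v = w := by
  classical
  let C := H.connectedComponentMk u
  have hsub : C.supp ⊆ insert u s := by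
    intro z hz
    obtain ⟨p⟩ := ConnectedComponent.exact hz
    cases p with
    | nil => exact Set.mem_insert _ _
    | cons h _ => exact Set.mem_insert_of_mem _ (hHs _ _ h.symm)
  have : Finite C.supp := (hs.insert u).subset hsub
  have : Fintype C := Fintype.ofFinite C.supp
  have hdeg : ∀ z : C, C.toSimpleGraph.degree z ≤ (H.neighborSet z.1).ncard := by
    intro z
    rw [← card_neighborFinset_eq_degree, ← Set.ncard_coe_finset]
    refine Set.ncard_le_ncard_of_injOn Subtype.val ?_ Subtype.val_injective.injOn (hfin _)
    intro t ht
    exact (C.toSimpleGraph.mem_neighborFinset _ _).1 ht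
  have key := C.connected_toSimpleGraph.eq_or_eq_or_eq_of_degree_le
    (fun z => (hdeg z).trans (h2 z.1))
    (u := ⟨u, rfl⟩) (v := ⟨v, ConnectedComponent.sound huv.symm⟩)
    (w := ⟨w, ConnectedComponent.sound huw.symm⟩)
    ((hdeg _).trans hu) ((hdeg _).trans hv) ((hdeg _).trans hw)
  simpa [Subtype.ext_iff] using key

end SimpleGraph

namespace Graph

variable {α β κ : Type*} {G : Graph α β} {S : Set β} {c : β → κ} {a b : κ} {e f : β}
  {x y u v w z : α}

/-! ### Proper colourings of a set of edges and missing colours -/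

/-- The colouring `c` is proper on the edge set `S`; its values outside `S` are irrelevant. -/
def IsProperOn (G : Graph α β) (S : Set β) (c : β → κ) : Prop :=
  ∀ f ∈ S, ∀ g ∈ S, f ≠ g → ∀ v, G.Inc f v → G.Inc g v → c f ≠ c g

/-- The colours missing at `v`: those of no edge of `S` incident with `v`. -/
def missing (G : Graph α β) (S : Set β) (c : β → κ) (v : α) : Set κ :=
  {t | ∀ f ∈ S, G.Inc f v → c f ≠ t}

theorem IsProperOn.eq_of_inc (hc : G.IsProperOn S c) {g : β} (hf : f ∈ S) (hg : g ∈ S)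
    (hfv : G.Inc f v) (hgv : G.Inc g v) (h : c f = c g) : f = g := by
  by_contra hne
  exact hc f hf g hg hne v hfv hgv h

theorem exists_of_notMem_missing (h : a ∉ G.missing S c v) : ∃ f ∈ S, G.Inc f v ∧ c f = a := by
  simpa [missing] using h

theorem IsProperOn.edgeColorable {k : ℕ} {c : β → Fin k} (hc : G.IsProperOn G.edgeSet c) :
    G.EdgeColorable k :=
  ⟨fun f => c f.1, fun f g hfg v hf hg =>
    hc f.1 f.2 g.1 g.2 (fun h => hfg (Subtype.ext h)) v hf hg⟩

theorem IsProperEdgeColoring.exists_isProperOn [Nonempty κ] {F : Set β}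
    {c : (G.deleteEdges F).edgeSet → κ} (hc : (G.deleteEdges F).IsProperEdgeColoring c) :
    ∃ c' : β → κ, G.IsProperOn (G.edgeSet \ F) c' := by
  classical
  refine ⟨fun f => if h : f ∈ (G.deleteEdges F).edgeSet then c ⟨f, h⟩ else Classical.arbitrary κ,
    fun f hf g hg hfg v hfv hgv => ?_⟩
  have hf' : f ∈ (G.deleteEdges F).edgeSet := by simpa using hf
  have hg' : g ∈ (G.deleteEdges F).edgeSet := by simpa using hg
  simp only [dif_pos hf', dif_pos hg']
  exact hc ⟨f, hf'⟩ ⟨g, hg'⟩ (by simpa using hfg) v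
    (by simpa using ⟨hfv, hf.2⟩) (by simpa using ⟨hgv, hg.2⟩)

theorem EdgeColorable.mono {k l : ℕ} (hkl : k ≤ l) (h : G.EdgeColorable k) : G.EdgeColorable l := by
  obtain ⟨c, hc⟩ := h
  exact ⟨fun f => Fin.castLE hkl (c f), fun f g hfg v hf hg h =>
    hc f g hfg v hf hg (Fin.castLE_injective hkl h)⟩

/-- Colours used at `v` correspond to the edges of `S` at `v`, so together with the missing ones
they account for all colours. -/
theorem IsProperOn.ncard_missing_add {k : ℕ} {c : β → Fin k} (hc : G.IsProperOn S c) (v : α) :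
    (G.missing S c v).ncard + (S ∩ G.incidenceSet v).ncard = k := by
  have hcompl : (G.missing S c v)ᶜ = c '' (S ∩ G.incidenceSet v) := by
    ext t
    simp [missing, and_assoc]
  have hinj : Set.InjOn c (S ∩ G.incidenceSet v) := fun f hf g hg h =>
    hc.eq_of_inc hf.1 hg.1 hf.2 hg.2 h
  rw [← hinj.ncard_image, ← hcompl, Set.ncard_add_ncard_compl, Nat.card_fin]

/-- Recolouring one edge by a colour missing at both of its ends. -/
theorem IsProperOn.update [DecidableEq β] (hc : G.IsProperOn S c) (hf : G.IsLink f x v)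
    (hx : a ∈ G.missing S c x) (hv : a ∈ G.missing S c v) :
    G.IsProperOn (insert f S) (Function.update c f a) := by
  have key : ∀ g ∈ S, ∀ w, G.Inc f w → G.Inc g w → c g ≠ a := by
    intro g hg w hfw hgw
    rcases hfw.eq_or_eq_of_isLink hf with rfl | rfl
    · exact hx g hg hgw
    · exact hv g hg hgw
  intro g hg g' hg' hne w hgw hgw'
  by_cases h1 : g = f <;> by_cases h2 : g' = f
  · exact absurd (h1.trans h2.symm) hne
  · subst h1
    rw [Function.update_self, Function.update_of_ne h2]
    exact (key g' (hg'.resolve_left h2) w hgw hgw').symm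
  · subst h2
    rw [Function.update_self, Function.update_of_ne h1]
    exact key g (hg.resolve_left h1) w hgw' hgw
  · rw [Function.update_of_ne h1, Function.update_of_ne h2]
    exact hc g (hg.resolve_left h1) g' (hg'.resolve_left h2) hne w hgw hgw'

/-! ### Kempe changes -/

/-- The graph whose components are the Kempe chains in the colours `a` and `b`: two vertices are
adjacent if an edge of `S` with one of these two colours joins them. -/
def kempeGraph (G : Graph α β) (S : Set β) (c : β → κ) (a b : κ) : SimpleGraph α where
  Adj u w := u ≠ w ∧ ∃ f ∈ S, G.IsLink f u w ∧ (c f = a ∨ c f = b)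
  symm := ⟨fun _ _ h => ⟨h.1.symm, h.2.imp fun _ hf => ⟨hf.1, hf.2.1.symm, hf.2.2⟩⟩⟩

theorem IsProperOn.subsingleton_setOf_isLink (hc : G.IsProperOn S c) (v : α) (t : κ) :
    {w | ∃ f ∈ S, G.IsLink f v w ∧ c f = t}.Subsingleton := by
  rintro w ⟨f, hf, hfw, hft⟩ w' ⟨g, hg, hgw, hgt⟩
  obtain rfl := hc.eq_of_inc hf hg hfw.inc_left hgw.inc_left (hft.trans hgt.symm)
  exact hfw.right_unique hgw

theorem kempeGraph_neighborSet (v : α) : (G.kempeGraph S c a b).neighborSet v ⊆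
    {w | ∃ f ∈ S, G.IsLink f v w ∧ c f = a} ∪ {w | ∃ f ∈ S, G.IsLink f v w ∧ c f = b} := by
  rintro w ⟨-, f, hf, hfw, h | h⟩
  · exact Or.inl ⟨f, hf, hfw, h⟩
  · exact Or.inr ⟨f, hf, hfw, h⟩

theorem IsProperOn.finite_kempeGraph_neighborSet (hc : G.IsProperOn S c) (v : α) :
    ((G.kempeGraph S c a b).neighborSet v).Finite :=
  ((hc.subsingleton_setOf_isLink v a).finite.union
    (hc.subsingleton_setOf_isLink v b).finite).subset (kempeGraph_neighborSet v)

theorem IsProperOn.ncard_kempeGraph_neighborSet_le_two (hc : G.IsProperOn S c) (v : α) :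
    ((G.kempeGraph S c a b).neighborSet v).ncard ≤ 2 := by
  have ha := hc.subsingleton_setOf_isLink v a
  have hb := hc.subsingleton_setOf_isLink v b
  have h1 := Set.ncard_le_ncard (kempeGraph_neighborSet (a := a) (b := b) v)
    (ha.finite.union hb.finite)
  have h2 := Set.ncard_union_le {w | ∃ f ∈ S, G.IsLink f v w ∧ c f = a}
    {w | ∃ f ∈ S, G.IsLink f v w ∧ c f = b}
  have := (Set.ncard_le_one ha.finite).2 fun _ h _ h' => ha h h'
  have := (Set.ncard_le_one hb.finite).2 fun _ h _ h' => hb h h'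
  omega

theorem IsProperOn.ncard_kempeGraph_neighborSet_le_one (hc : G.IsProperOn S c)
    (h : a ∈ G.missing S c v ∨ b ∈ G.missing S c v) :
    ((G.kempeGraph S c a b).neighborSet v).ncard ≤ 1 := by
  suffices h' : ((G.kempeGraph S c a b).neighborSet v).Subsingleton from
    (Set.ncard_le_one h'.finite).2 fun _ hs _ ht => h' hs ht
  rcases h with h | h
  · refine (hc.subsingleton_setOf_isLink v b).anti ?_
    rintro w ⟨-, f, hf, hfw, hfa | hfb⟩
    · exact absurd hfa (h f hf hfw.inc_left)
    · exact ⟨f, hf, hfw, hfb⟩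
  · refine (hc.subsingleton_setOf_isLink v a).anti ?_
    rintro w ⟨-, f, hf, hfw, hfa | hfb⟩
    · exact ⟨f, hf, hfw, hfa⟩
    · exact absurd hfb (h f hf hfw.inc_left)

/-- A Kempe chain is a path or a cycle, so at most two of its vertices miss one of its two
colours. -/
theorem IsProperOn.eq_or_eq_or_eq_of_reachable (hV : G.vertexSet.Finite) (hc : G.IsProperOn S c)
    (hu : a ∈ G.missing S c u ∨ b ∈ G.missing S c u)
    (hv : a ∈ G.missing S c v ∨ b ∈ G.missing S c v)
    (hw : a ∈ G.missing S c w ∨ b ∈ G.missing S c w)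
    (huv : (G.kempeGraph S c a b).Reachable u v) (huw : (G.kempeGraph S c a b).Reachable u w) :
    u = v ∨ u = w ∨ v = w :=
  SimpleGraph.eq_or_eq_or_eq_of_reachable hV
    (by rintro v w ⟨-, f, -, hf, -⟩; exact hf.right_mem)
    hc.finite_kempeGraph_neighborSet hc.ncard_kempeGraph_neighborSet_le_two
    (hc.ncard_kempeGraph_neighborSet_le_one hu) (hc.ncard_kempeGraph_neighborSet_le_one hv)
    (hc.ncard_kempeGraph_neighborSet_le_one hw) huv huw

open Classical in
/-- The Kempe change at `v`: the colours `a` and `b` are exchanged on all edges that meet the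
Kempe chain of `v`. -/
noncomputable def kempeSwap (G : Graph α β) (S : Set β) (c : β → κ) (a b : κ) (v : α) (f : β) : κ :=
  if ∃ z, (G.kempeGraph S c a b).Reachable v z ∧ G.Inc f z then Equiv.swap a b (c f) else c f

open Classical in
theorem kempeSwap_of_reachable (h : (G.kempeGraph S c a b).Reachable v z) (hz : G.Inc f z) :
    G.kempeSwap S c a b v f = Equiv.swap a b (c f) :=
  if_pos ⟨z, h, hz⟩

/-- Only the end `z` of `f` matters: if the chain contains the other end of `f` and not `z`, then
the colour of `f` is neither `a` nor `b`. -/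
theorem kempeSwap_of_not_reachable (hf : f ∈ S) (h : ¬ (G.kempeGraph S c a b).Reachable v z)
    (hz : G.Inc f z) : G.kempeSwap S c a b v f = c f := by
  classical
  unfold kempeSwap
  split_ifs with hex
  · obtain ⟨w, hw, hfw⟩ := hex
    have hwz : w ≠ z := fun h' => h (h' ▸ hw)
    have hlink : G.IsLink f w z := by
      obtain ⟨w', hw'⟩ := hfw
      rcases hz.eq_or_eq_of_isLink hw' with rfl | rfl
      · exact absurd rfl hwz
      · exact hw'
    have hne : ∀ t, (t = a ∨ t = b) → c f ≠ t := fun t ht hft =>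
      h (hw.trans (SimpleGraph.Adj.reachable ⟨hwz, f, hf, hlink, hft ▸ ht⟩))
    exact Equiv.swap_apply_of_ne_of_ne (hne a (.inl rfl)) (hne b (.inr rfl))
  · rfl

theorem IsProperOn.kempeSwap (hc : G.IsProperOn S c) (a b : κ) (v : α) :
    G.IsProperOn S (G.kempeSwap S c a b v) := by
  classical
  intro f hf g hg hne z hfz hgz
  by_cases hz : (G.kempeGraph S c a b).Reachable v z
  · rw [kempeSwap_of_reachable hz hfz, kempeSwap_of_reachable hz hgz]
    exact fun h => hc f hf g hg hne z hfz hgz ((Equiv.swap a b).injective h)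
  · rw [kempeSwap_of_not_reachable hf hz hfz, kempeSwap_of_not_reachable hg hz hgz]
    exact hc f hf g hg hne z hfz hgz

theorem missing_kempeSwap_of_not_reachable (h : ¬ (G.kempeGraph S c a b).Reachable v z) :
    G.missing S (G.kempeSwap S c a b v) z = G.missing S c z := by
  ext t
  refine forall₃_congr fun f hf hfz => ?_
  rw [kempeSwap_of_not_reachable hf h hfz]

open Classical in
theorem mem_missing_kempeSwap_of_reachable (h : (G.kempeGraph S c a b).Reachable v z) (t : κ) :
    t ∈ G.missing S (G.kempeSwap S c a b v) z ↔ Equiv.swap a b t ∈ G.missing S c z := by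
  refine forall₃_congr fun f hf hfz => ?_
  rw [kempeSwap_of_reachable h hfz, ne_eq, ne_eq, ← Equiv.swap_apply_eq_iff]

theorem left_mem_missing_kempeSwap (h : b ∈ G.missing S c v) :
    a ∈ G.missing S (G.kempeSwap S c a b v) v := by
  classical
  rw [mem_missing_kempeSwap_of_reachable (SimpleGraph.Reachable.refl v), Equiv.swap_apply_left]
  exact h

/-- A Kempe change does not affect whether a colour other than `a` and `b` is missing. -/
theorem mem_missing_kempeSwap_of_ne {t : κ} (ha : t ≠ a) (hb : t ≠ b) :
    t ∈ G.missing S (G.kempeSwap S c a b v) z ↔ t ∈ G.missing S c z := by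
  classical
  by_cases h : (G.kempeGraph S c a b).Reachable v z
  · rw [mem_missing_kempeSwap_of_reachable h, Equiv.swap_apply_of_ne_of_ne ha hb]
  · rw [missing_kempeSwap_of_not_reachable h]

/-! ### Fans -/

/-- `G.FanReach S c x y n v` means that `v` is reached from `y` in `n` steps of a fan at `x`: each
step leads along an edge of `S` at `x` whose colour is missing at the previous vertex. -/
def FanReach (G : Graph α β) (S : Set β) (c : β → κ) (x y : α) : ℕ → α → Prop
  | 0, v => v = y
  | n + 1, v => ∃ u, G.FanReach S c x y n u ∧ ∃ f ∈ S, G.IsLink f x v ∧ c f ∈ G.missing S c u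

/-- If the edge `e` from `x` to `y` cannot be coloured, no colour is missing both at `x` and at a
vertex `v` of a fan. Otherwise, with `v` reached as early as possible, recolour the edge `f` leading
to `v` with the common missing colour: then the old colour of `f` is missing both at `x` and at the
predecessor of `v`. -/
theorem FanReach.disjoint_missing [G.Loopless] (hxy : G.IsLink e x y)
    (hN : ∀ c' : β → κ, ¬ G.IsProperOn (insert e S) c') {n : ℕ} (hc : G.IsProperOn S c)
    (hv : G.FanReach S c x y n v) : Disjoint (G.missing S c x) (G.missing S c v) := by
  classical
  induction n using Nat.strong_induction_on generalizing c v with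
  | _ n ih =>
    rw [Set.disjoint_left]
    intro a hax hav
    cases n with
    | zero =>
      obtain rfl : v = y := hv
      exact hN _ (hc.update hxy hax hav)
    | succ n =>
      obtain ⟨u, hu, f, hf, hfv, hfu⟩ := hv
      by_cases hearly : ∃ m ≤ n, G.FanReach S c x y m v
      · obtain ⟨m, hm, hmv⟩ := hearly
        exact Set.disjoint_left.1 (ih m (by omega) hc hmv) hax hav
      push Not at hearly
      have hc' : G.IsProperOn S (Function.update c f a) := by
        simpa [Set.insert_eq_of_mem hf] using hc.update hfv hax hav
      have hmiss : ∀ w, w ≠ x → w ≠ v →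
          G.missing S (Function.update c f a) w = G.missing S c w := by
        intro w hwx hwv
        ext t
        refine forall₃_congr fun g _ hgw => ?_
        rw [Function.update_of_ne]
        rintro rfl
        rcases hgw.eq_or_eq_of_isLink hfv with h | h
        · exact hwx h
        · exact hwv h
      have hnex : ∀ m w, G.FanReach S c x y m w → w ≠ x := by
        rintro (_ | m) w hw
        · obtain rfl : w = y := hw
          exact hxy.ne.symm
        · obtain ⟨_, -, g, -, hgw, -⟩ := hw
          exact hgw.ne.symm
      have hreach : ∀ m ≤ n, ∀ w, G.FanReach S c x y m w →
          G.FanReach S (Function.update c f a) x y m w := by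
        intro m
        induction m with
        | zero => exact fun _ w hw => hw
        | succ m ihm =>
          intro hm w hw
          have hwv : w ≠ v := fun h => hearly (m + 1) hm (h ▸ hw)
          obtain ⟨z, hz, g, hg, hgw, hgz⟩ := hw
          refine ⟨z, ihm (by omega) z hz, g, hg, hgw, ?_⟩
          have hgf : g ≠ f := by
            rintro rfl
            exact hwv (hgw.right_unique hfv)
          rw [Function.update_of_ne hgf,
            hmiss z (hnex m z hz) fun h => hearly m (by omega) (h ▸ hz)]
          exact hgz
      have huv : u ≠ v := fun h => hearly n le_rfl (h ▸ hu)
      have hdisj := Set.disjoint_left.1 (ih n (by omega) hc' (hreach n le_rfl u hu))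
      refine hdisj (a := c f) ?_ ?_
      · intro g hg hgx
        by_cases hgf : g = f
        · subst hgf
          rw [Function.update_self]
          exact (hax g hg hgx).symm
        · rw [Function.update_of_ne hgf]
          exact hc g hg f hf hgf x hgx hfv.inc_left
      · rw [hmiss u (hnex n u hu) huv]
        exact hfu

/-- A Kempe change away from `x` keeps the fan up to the first vertices that miss `b`, as no fan
edge up to there has one of the two colours. -/
theorem FanReach.kempeSwap_of_forall_lt (hax : a ∈ G.missing S c x)
    (hx : ¬ (G.kempeGraph S c a b).Reachable v x) {n : ℕ}
    (hn : ∀ m < n, ∀ z, G.FanReach S c x y m z → b ∉ G.missing S c z)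
    (hw : G.FanReach S c x y n w) : G.FanReach S (G.kempeSwap S c a b v) x y n w := by
  induction n generalizing w with
  | zero => exact hw
  | succ n ih =>
    obtain ⟨z, hz, f, hf, hfw, hfz⟩ := hw
    refine ⟨z, ih (fun m hm => hn m (by omega)) hz, f, hf, hfw, ?_⟩
    have hfb : c f ≠ b := fun h => hn n (by omega) z hz (h ▸ hfz)
    rw [kempeSwap_of_not_reachable hf hx hfw.inc_left,
      mem_missing_kempeSwap_of_ne (hax f hf hfw.inc_left) hfb]
    exact hfz

/-- A Kempe change away from `x` keeps all fan vertices if some fan vertex `u` still misses `b`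
after it: fan edges coloured `b` may then be preceded by `u`. -/
theorem FanReach.kempeSwap_of_mem_missing (hax : a ∈ G.missing S c x)
    (hx : ¬ (G.kempeGraph S c a b).Reachable v x) {m n : ℕ}
    (hu : G.FanReach S (G.kempeSwap S c a b v) x y m u)
    (hub : b ∈ G.missing S (G.kempeSwap S c a b v) u)
    (hw : G.FanReach S c x y n w) : ∃ n', G.FanReach S (G.kempeSwap S c a b v) x y n' w := by
  induction n generalizing w with
  | zero => exact ⟨0, hw⟩
  | succ n ih =>
    obtain ⟨z, hz, f, hf, hfw, hfz⟩ := hw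
    have hswap := kempeSwap_of_not_reachable hf hx hfw.inc_left
    by_cases hfb : c f = b
    · refine ⟨m + 1, u, hu, f, hf, hfw, ?_⟩
      rwa [hswap, hfb]
    · obtain ⟨n', hz'⟩ := ih hz
      refine ⟨n' + 1, z, hz', f, hf, hfw, ?_⟩
      rwa [hswap, mem_missing_kempeSwap_of_ne (hax f hf hfw.inc_left) hfb]

/-- If the edge `e` from `x` to `y` cannot be coloured and some colour `a` is missing at `x`, then no
colour `b` is missing at two vertices of a fan. Otherwise let `u` be a first fan vertex missing `b`
and `v` another one. As `x`, `u` and `v` are not all in the same Kempe chain, a Kempe change at `u`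
or at `v` avoids `x` and makes `a` missing at a fan vertex. -/
theorem FanReach.eq_of_mem_missing [G.Loopless] (hV : G.vertexSet.Finite) (hxy : G.IsLink e x y)
    (hN : ∀ c' : β → κ, ¬ G.IsProperOn (insert e S) c') (hc : G.IsProperOn S c)
    (hax : a ∈ G.missing S c x) {m n : ℕ} (hv : G.FanReach S c x y m v)
    (hw : G.FanReach S c x y n w) (hbv : b ∈ G.missing S c v) (hbw : b ∈ G.missing S c w) :
    v = w := by
  classical
  have hex : ∃ l u, G.FanReach S c x y l u ∧ b ∈ G.missing S c u := ⟨m, v, hv, hbv⟩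
  obtain ⟨u, hu, hbu⟩ := Nat.find_spec hex
  have hmin : ∀ l < Nat.find hex, ∀ z, G.FanReach S c x y l z → b ∉ G.missing S c z :=
    fun l hl z hz hbz => Nat.find_min hex hl ⟨z, hz, hbz⟩
  suffices key : ∀ {l z}, G.FanReach S c x y l z → b ∈ G.missing S c z → z = u from
    (key hv hbv).trans (key hw hbw).symm
  intro l z hz hbz
  by_contra hzu
  have hbx : b ∉ G.missing S c x := fun h =>
    Set.disjoint_left.1 (hz.disjoint_missing hxy hN hc) h hbz
  have hxz : x ≠ z := fun h => hbx (h ▸ hbz)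
  have hxu : x ≠ u := fun h => hbx (h ▸ hbu)
  -- A Kempe change at `s` that avoids `x` cannot leave `s` reachable by a fan.
  have hcontra : ∀ s l', ¬ (G.kempeGraph S c a b).Reachable s x → b ∈ G.missing S c s →
      ¬ G.FanReach S (G.kempeSwap S c a b s) x y l' s := by
    intro s l' hs hbs hfan
    refine Set.disjoint_left.1 (hfan.disjoint_missing hxy hN (hc.kempeSwap a b s)) ?_
      (left_mem_missing_kempeSwap hbs)
    rwa [missing_kempeSwap_of_not_reachable hs]
  by_cases hru : (G.kempeGraph S c a b).Reachable u x
  · have hrz : ¬ (G.kempeGraph S c a b).Reachable z x := fun h => by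
      rcases hc.eq_or_eq_or_eq_of_reachable hV (.inl hax) (.inr hbu) (.inr hbz) hru.symm h.symm
        with h | h | h
      · exact hxu h
      · exact hxz h
      · exact hzu h.symm
    have hzu' : ¬ (G.kempeGraph S c a b).Reachable z u := fun h => hrz (h.trans hru)
    obtain ⟨n', hz'⟩ := FanReach.kempeSwap_of_mem_missing hax hrz
      (hu.kempeSwap_of_forall_lt hax hrz hmin)
      (by rwa [missing_kempeSwap_of_not_reachable hzu']) hz
    exact hcontra z n' hrz hbz hz'
  · exact hcontra u _ hru hbu (hu.kempeSwap_of_forall_lt hax hru hmin)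

theorem FanReach.isLink [G.Loopless] (hxy : G.IsLink e x y) {n : ℕ}
    (hv : G.FanReach S c x y n v) : ∃ f ∈ insert e S, G.IsLink f x v := by
  cases n with
  | zero =>
    obtain rfl : v = y := hv
    exact ⟨e, Set.mem_insert _ _, hxy⟩
  | succ n =>
    obtain ⟨_, -, f, hf, hfv, -⟩ := hv
    exact ⟨f, Set.mem_insert_of_mem _ hf, hfv⟩

/-! ### The fan equation -/

/-- Vizing's fan inequality for a colouring of all edges but `e`, summed over all vertices that
fans starting with `e` reach. The edges at `x` coloured with a colour missing at one of these
vertices lead again to such vertices, and there is exactly one such edge for each such colour. -/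
theorem IsProperOn.exists_fan [G.Loopless] (hV : G.vertexSet.Finite) (hE : G.edgeSet.Finite)
    {k : ℕ} {c : β → Fin k} (hc : G.IsProperOn (G.edgeSet \ {e}) c) (hxy : G.IsLink e x y)
    (hk : ∀ v ∈ G.vertexSet, G.degree v ≤ k) (hN : ¬ G.EdgeColorable k) :
    ∃ X : Finset α, (X : Set α) ⊆ G.neighbours x ∧ y ∈ X ∧ 2 ≤ X.card ∧
      (2 : ℤ) ≤ ∑ v ∈ X, ((G.degree v : ℤ) + G.multiplicity x v - k) := by
  classical
  set S : Set β := G.edgeSet \ {e} with hS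
  have heE : insert e S = G.edgeSet := by
    rw [hS, Set.insert_sdiff_singleton, Set.insert_eq_of_mem hxy.edge_mem]
  have hN' : ∀ c' : β → Fin k, ¬ G.IsProperOn (insert e S) c' := fun c' h =>
    hN (IsProperOn.edgeColorable (heE ▸ h))
  have hfinite : ∀ v, (G.incidenceSet v).Finite := fun v =>
    hE.subset (G.incidenceSet_subset_edgeSet v)
  have hSinc : ∀ v, S ∩ G.incidenceSet v = G.incidenceSet v \ {e} := fun v => by
    ext f
    simp only [hS, Set.mem_inter_iff, Set.mem_sdiff, mem_incidenceSet]
    exact ⟨fun h => ⟨h.2, h.1.2⟩, fun h => ⟨⟨h.1.edge_mem, h.2⟩, h.1⟩⟩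
  -- `e` is uncoloured, so each of its ends misses one colour more.
  have hmiss_end : ∀ v, G.Inc e v → (G.missing S c v).ncard + G.degree v = k + 1 := by
    intro v hv
    have h1 := hc.ncard_missing_add v
    rw [hSinc] at h1
    have h2 : (G.incidenceSet v \ {e}).ncard + 1 = G.degree v :=
      Set.ncard_sdiff_singleton_add_one hv (hfinite v)
    omega
  have hmiss : ∀ v, k ≤ (G.missing S c v).ncard + G.degree v := by
    intro v
    have h1 := hc.ncard_missing_add v
    rw [hSinc] at h1
    have h2 : (G.incidenceSet v \ {e}).ncard ≤ G.degree v :=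
      Set.ncard_le_ncard Set.sdiff_subset (hfinite v)
    omega
  have hnonempty : ∀ v, G.Inc e v → (G.missing S c v).Nonempty := by
    intro v hv
    refine Set.nonempty_of_ncard_ne_zero ?_
    have := hmiss_end v hv
    have := hk v hv.vertex_mem
    omega
  obtain ⟨a, hax⟩ := hnonempty x hxy.inc_left
  have hXfin : {v | ∃ n, G.FanReach S c x y n v}.Finite := by
    refine hV.subset ?_
    rintro v ⟨n, hv⟩
    obtain ⟨f, -, hf⟩ := hv.isLink hxy
    exact hf.right_mem
  have hX : ∀ v, v ∈ hXfin.toFinset ↔ ∃ n, G.FanReach S c x y n v := by simp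
  set X := hXfin.toFinset
  have hyX : y ∈ X := (hX y).2 ⟨0, rfl⟩
  -- The fan cannot be extended.
  have hmax : ∀ v ∈ X, ∀ f ∈ S, ∀ w, G.IsLink f x w → c f ∈ G.missing S c v → w ∈ X := by
    intro v hv f hf w hfw hfv
    obtain ⟨n, hn⟩ := (hX v).1 hv
    exact (hX w).2 ⟨n + 1, v, hn, f, hf, hfw, hfv⟩
  have hdisjx : ∀ v ∈ X, ∀ t ∈ G.missing S c v, ∃ f ∈ S, G.Inc f x ∧ c f = t := by
    intro v hv t ht
    obtain ⟨n, hn⟩ := (hX v).1 hv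
    exact exists_of_notMem_missing fun h =>
      Set.disjoint_left.1 (hn.disjoint_missing hxy hN' hc) h ht
  have hdisj : (X : Set α).PairwiseDisjoint (G.missing S c) := by
    intro v hv w hw hvw
    obtain ⟨n, hn⟩ := (hX v).1 hv
    obtain ⟨m, hm⟩ := (hX w).1 hw
    exact Set.disjoint_left.2 fun b hbv hbw =>
      hvw (hn.eq_of_mem_missing hV hxy hN' hc hax hm hbv hbw)
  refine ⟨X, ?_, hyX, ?_, ?_⟩
  · intro v hv
    obtain ⟨n, hn⟩ := (hX v).1 hv
    obtain ⟨f, -, hf⟩ := hn.isLink hxy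
    exact hf.adj
  · obtain ⟨t, ht⟩ := hnonempty y hxy.inc_right
    obtain ⟨f, hf, ⟨w, hfw⟩, rfl⟩ := hdisjx y hyX t ht
    refine Finset.one_lt_card.2 ⟨y, hyX, w, hmax y hyX f hf w hfw ht, ?_⟩
    rintro rfl
    exact ht f hf hfw.inc_right rfl
  · let F : Set β := {f | f ∈ S ∧ G.Inc f x ∧ ∃ v ∈ X, c f ∈ G.missing S c v}
    have hFfin : F.Finite := (hfinite x).subset fun f hf => hf.2.1
    have heF : e ∉ F := fun h => h.1.2 rfl
    have hcolors : ∑ v ∈ X, (G.missing S c v).ncard ≤ F.ncard := by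
      rw [← finsum_mem_coe_finset, ← X.finite_toSet.ncard_biUnion (fun _ _ => Set.toFinite _) hdisj]
      refine (Set.ncard_le_ncard ?_ (hFfin.image c)).trans (Set.ncard_image_le hFfin)
      intro t ht
      obtain ⟨v, hv, htv⟩ := Set.mem_iUnion₂.1 ht
      obtain ⟨f, hf, hfx, rfl⟩ := hdisjx v hv t htv
      exact ⟨f, ⟨hf, hfx, v, hv, htv⟩, rfl⟩
    have hedges : F.ncard + 1 ≤ ∑ v ∈ X, G.multiplicity x v := by
      rw [← Set.ncard_insert_of_notMem heF hFfin]
      refine (Set.ncard_le_ncard ?_ ?_).trans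
        (X.set_ncard_biUnion_le fun v => {f | G.IsLink f x v})
      · rintro f (rfl | ⟨hf, ⟨w, hfw⟩, v, hv, hfv⟩)
        · exact Set.mem_biUnion hyX hxy
        · exact Set.mem_biUnion (hmax v hv f hf w hfw hfv) hfw
      · exact X.finite_toSet.biUnion fun v _ => (hfinite x).subset fun f hf => hf.inc_left
    have hdegrees : (∑ _v ∈ X, k) + 1 ≤ ∑ v ∈ X, ((G.missing S c v).ncard + G.degree v) := by
      rw [← Finset.add_sum_erase X (fun _ => k) hyX, ← Finset.add_sum_erase X (fun v => _ + _) hyX,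
        hmiss_end y hxy.inc_right]
      have := Finset.sum_le_sum fun v (_ : v ∈ X.erase y) => hmiss v
      omega
    rw [Finset.sum_add_distrib] at hdegrees
    have h : (∑ _v ∈ X, k) + 2 ≤ ∑ v ∈ X, G.degree v + ∑ v ∈ X, G.multiplicity x v := by omega
    rw [Finset.sum_sub_distrib, Finset.sum_add_distrib, le_sub_iff_add_le']
    exact_mod_cast h

end Graph

theorem mainTheorem3 {α β : Type*} (G : Graph α β) [G.Loopless]
    (hV : G.vertexSet.Finite) (hE : G.edgeSet.Finite)
    (hχ : G.maxDegree + 1 ≤ G.chromaticIndex)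
    (e : β) (x y : α) (hxy : G.IsLink e x y) (hcrit : G.IsCriticalEdge e) :
    ∃ X : Finset α, (X : Set α) ⊆ G.neighbours x ∧ y ∈ X ∧ 2 ≤ X.card ∧
      (2 : ℤ) ≤ ∑ v ∈ X,
        ((G.degree v : ℤ) + (G.multiplicity x v : ℤ) + 1 - (G.chromaticIndex : ℤ)) := by
  obtain ⟨k, hk⟩ : ∃ k, G.chromaticIndex = k + 1 := ⟨G.chromaticIndex - 1, by omega⟩
  have hdeg : ∀ v ∈ G.vertexSet, G.degree v ≤ k := fun v hv => by
    have := G.degree_le_maxDegree hV hv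
    omega
  have hN : ¬ G.EdgeColorable k := fun h => by
    have : G.chromaticIndex ≤ k := Nat.sInf_le h
    omega
  -- A colour is needed to extend the colouring of `G - e` by an arbitrary value to all of `β`.
  have hkpos : 0 < k := by
    have : 0 < G.degree x :=
      (Set.ncard_pos (hE.subset (G.incidenceSet_subset_edgeSet x))).2 ⟨e, hxy.inc_left⟩
    exact this.trans_le (hdeg x hxy.left_mem)
  have : Nonempty (Fin k) := ⟨⟨0, hkpos⟩⟩
  have hE' : (G.deleteEdges {e}).edgeSet.Finite := by
    simpa using hE.sdiff
  have hcrit' := hcrit.2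
  obtain ⟨c₀, hc₀⟩ : (G.deleteEdges {e}).EdgeColorable k :=
    ((G.deleteEdges {e}).edgeColorable_chromaticIndex hE').mono (by omega)
  obtain ⟨c, hc⟩ := hc₀.exists_isProperOn
  obtain ⟨X, hXN, hyX, hX2, hsum⟩ := hc.exists_fan hV hE hxy hdeg hN
  refine ⟨X, hXN, hyX, hX2, hsum.trans_eq (Finset.sum_congr rfl fun v _ => ?_)⟩
  rw [hk]
  push_cast
  ring
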